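/- Bayesian contextual bandit. Let $\mathcal X$ (contexts) be a measurable space, $\mathcal A$ (actions) a finite nonempty set and $\mathcal O$ (parameters) a standard Borel space. A bandit is given by a prior $\mathbb P_\Theta$ on $\mathcal O$, a context distribution $\mathbb P_X$ on $\mathcal X$, and a Markov kernel $\kappa$ from $\mathcal X\times\mathcal A\times\mathcal O$ to $\mathbb R$; for $x\in\mathcal X$, $a\in\mathcal A$, $\theta\in\mathcal O$ the random reward $R(x,a,\theta)$ has law $\kappa(\cdot,(x,a,\theta))$. Let $T$ be the number of rounds and let $\psi^\star:\mathcal X\times\mathcal O\to\mathcal A$ be an optimal policy, i.e. a measurable rule that maximizes $\mathbb E\big[\sum_{t=1}^T R(X_t,\psi(X_t,\Theta),\Theta)\big]$ over the measurable rules $\psi$ for which this expectation is defined (the rewards are integrable), where $\Theta\sim\mathbb P_\Theta$ and $X_t\sim\mathbb P_X$ are independent. Thompson sampling. $\Theta\sim\mathbb P_\Theta$, and in each round $t=1,\dots,T$, with $\hat H^t=\big((\hat A_s,X_s,R_s)\big)_{s<t}$: the context $X_t\sim\mathbb P_X$ is drawn independently of $(\hat H^t,\Theta)$; given $(\hat H^t,X_t,\Theta)$,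 a parameter $\hat\Theta_t$ is drawn from the posterior $\mathbb P_{\Theta\mid\hat H^t}$; the action $\hat A_t=\psi^\star(X_t,\hat\Theta_t)$ is taken; and the reward $R_t=R'_t(\hat A_t)$ is collected, where for each $a\in\mathcal A$ the reward $R'_t(a)=R(X_t,a,\Theta)$ has law $\kappa(\cdot,(X_t,a,\Theta))$ given $(\hat H^t,X_t,\Theta,\hat\Theta_t)$. Put $R^\star_t=R'_t(\psi^\star(X_t,\Theta))$. Write $\mathbb E_t[\cdot]=\mathbb E[\cdot\mid\hat H^t,X_t]$, $$\mathrm I_t(\Theta;R_t\mid\hat A_t)=\mathbb E_t\Big[\mathrm D_{\mathrm{KL}}\big(\mathbb P_{R_t\mid\hat H^t,X_t,\hat A_t,\Theta}\,\big\|\,\mathbb P_{R_t\mid\hat H^t,X_t,\hat A_t}\big)\Big],\qquad \Gamma_t=\frac{\mathbb E_t[R^\star_t-R_t]^2}{\mathrm I_t(\Theta;R_t\mid\hat A_t)}\in[0,\infty],$$ with the conventions $0/0=0$, $c/0=\infty$ for $c>0$, and $c/\infty=0$. Lemma. Let $\sigma\ge 0$. Suppose that for every $t\in\{1,\dots,T\}$,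 every action $a\in\mathcal A$ and $\mathbb P_{\hat H^t,X_t}$-almost every $(h,x)$, the reward $R'_t(a)$ is $\sigma^2$-sub-Gaussian under $\mathbb P_{R'_t(a)\mid\hat H^t=h,X_t=x}$, that is, with $\mathbb E_{h,x}$ the expectation under this law, $\mathbb E_{h,x}\big[e^{\lambda(R'_t(a)-\mathbb E_{h,x}[R'_t(a)])}\big]\le e^{\lambda^2\sigma^2/2}$ for all $\lambda\in\mathbb R$. Then for every $t\in\{1,\dots,T\}$, almost surely, $$\Gamma_t\le 2\sigma^2|\mathcal A| .$$ -/

import Mathlib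

open MeasureTheory ProbabilityTheory InformationTheory
open scoped NNReal ENNReal

noncomputable section

/-- A Bayesian contextual bandit problem with contexts `𝒳`, actions `𝒜` and parameters `𝒪`:
a prior on the parameters, a context distribution and a reward kernel. -/
structure ContextualBandit (𝒳 𝒜 𝒪 : Type*)
    [MeasurableSpace 𝒳] [MeasurableSpace 𝒜] [MeasurableSpace 𝒪] where
  /-- The law of the environment parameter. -/
  prior : Measure 𝒪
  /-- The law of the context in each round. -/
  ctx : Measure 𝒳
  /-- The law of the reward, given the context, the action and the parameter. -/
  reward : Kernel (𝒳 × 𝒜 × 𝒪) ℝ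
  [prior_prob : IsProbabilityMeasure prior]
  [ctx_prob : IsProbabilityMeasure ctx]
  [reward_markov : IsMarkovKernel reward]

namespace ContextualBandit

attribute [instance] prior_prob ctx_prob reward_markov

variable {𝒳 𝒜 𝒪 : Type*} [MeasurableSpace 𝒳] [MeasurableSpace 𝒜] [MeasurableSpace 𝒪]

/-- The law of `R(X, ψ(X, Θ), Θ)`, where `X ∼ ctx` and `Θ ∼ prior` are independent. -/
def ruleRewardLaw (B : ContextualBandit 𝒳 𝒜 𝒪) (ψ : 𝒳 × 𝒪 → 𝒜) : Measure ℝ :=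
  ((B.ctx.prod B.prior).map fun p => (p.1, ψ p, p.2)).bind B.reward

/-- The expected cumulative reward over `T` rounds of the decision rule `ψ`,
`E[∑ t, R(X_t, ψ(X_t, Θ), Θ)]`. -/
def ruleValue (B : ContextualBandit 𝒳 𝒜 𝒪) (T : ℕ) (ψ : 𝒳 × 𝒪 → 𝒜) : ℝ :=
  ∑ _t : Fin T, ∫ r, r ∂(B.ruleRewardLaw ψ)

/-- The decision rules for which the expected cumulative reward is defined. -/
def IsAdmissible (B : ContextualBandit 𝒳 𝒜 𝒪) (ψ : 𝒳 × 𝒪 → 𝒜) : Prop :=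
  Measurable ψ ∧ Integrable (fun r : ℝ => r) (B.ruleRewardLaw ψ)

/-- `ψ` is an optimal policy over `T` rounds: it attains the optimal cumulative reward. -/
def IsOptimal (B : ContextualBandit 𝒳 𝒜 𝒪) (T : ℕ) (ψ : 𝒳 × 𝒪 → 𝒜) : Prop :=
  B.IsAdmissible ψ ∧ ∀ ψ' : 𝒳 × 𝒪 → 𝒜, B.IsAdmissible ψ' → B.ruleValue T ψ' ≤ B.ruleValue T ψ

end ContextualBandit

/-- The random variables of a run of `T` rounds of Thompson sampling (with no constraint yet on
their joint law). Rounds are numbered by `Fin T`. -/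
structure BanditRun (𝒳 𝒜 𝒪 Ω : Type*) (T : ℕ) where
  /-- The true environment parameter `Θ`. -/
  param : Ω → 𝒪
  /-- The context `X_t`. -/
  context : Fin T → Ω → 𝒳
  /-- The sampled parameter `Θ̂_t`. -/
  sample : Fin T → Ω → 𝒪
  /-- `potential t a` is the random reward `R(X_t, a, Θ)` of the action `a` in round `t`. -/
  potential : Fin T → 𝒜 → Ω → ℝ

namespace BanditRun

variable {𝒳 𝒜 𝒪 Ω : Type*} {T : ℕ}

/-- The action `Â_t = ψ(X_t, Θ̂_t)` taken by the algorithm. -/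
def action (S : BanditRun 𝒳 𝒜 𝒪 Ω T) (ψ : 𝒳 × 𝒪 → 𝒜) (t : Fin T) (ω : Ω) : 𝒜 :=
  ψ (S.context t ω, S.sample t ω)

/-- The optimal action `A⋆_t = ψ(X_t, Θ)`. -/
def optAction (S : BanditRun 𝒳 𝒜 𝒪 Ω T) (ψ : 𝒳 × 𝒪 → 𝒜) (t : Fin T) (ω : Ω) : 𝒜 :=
  ψ (S.context t ω, S.param ω)

/-- The reward `R_t = R(X_t, Â_t, Θ)` collected by the algorithm. -/
def reward (S : BanditRun 𝒳 𝒜 𝒪 Ω T) (ψ : 𝒳 × 𝒪 → 𝒜) (t : Fin T) (ω : Ω) : ℝ :=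
  S.potential t (S.action ψ t ω) ω

/-- The reward `R⋆_t = R(X_t, A⋆_t, Θ)` collected by playing optimally. -/
def optReward (S : BanditRun 𝒳 𝒜 𝒪 Ω T) (ψ : 𝒳 × 𝒪 → 𝒜) (t : Fin T) (ω : Ω) : ℝ :=
  S.potential t (S.optAction ψ t ω) ω

/-- The history `Ĥ^t`: actions, contexts and rewards of the rounds before `t`. -/
def history (S : BanditRun 𝒳 𝒜 𝒪 Ω T) (ψ : 𝒳 × 𝒪 → 𝒜) (t : Fin T) (ω : Ω) :
    Fin (t : ℕ) → 𝒜 × 𝒳 × ℝ :=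
  fun s =>
    let s' : Fin T := Fin.castLE t.isLt.le s
    (S.action ψ s' ω, S.context s' ω, S.reward ψ s' ω)

/-- The pair `(Ĥ^t, X_t)` of the history and the current context. -/
def info (S : BanditRun 𝒳 𝒜 𝒪 Ω T) (ψ : 𝒳 × 𝒪 → 𝒜) (t : Fin T) (ω : Ω) :
    (Fin (t : ℕ) → 𝒜 × 𝒳 × ℝ) × 𝒳 :=
  (S.history ψ t ω, S.context t ω)

variable [MeasurableSpace 𝒳] [MeasurableSpace 𝒜] [MeasurableSpace 𝒪] [MeasurableSpace Ω]

/-- The random variables `S` on `(Ω, P)` are a run of Thompson sampling on the bandit `B`, where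
actions are chosen from the sampled parameters by the rule `ψ`: in each round `t`
* the context is drawn from `B.ctx`, independently of the past and of `Θ`;
* `Θ̂_t` is drawn from the posterior of `Θ` given `Ĥ^t`, independently of `X_t` and `Θ`;
* the reward of each action `a` is drawn from the reward kernel at `(X_t, a, Θ)`, whatever
  `Ĥ^t` and `Θ̂_t` are. -/
structure IsThompsonSampling [StandardBorelSpace 𝒪] [Nonempty 𝒪]
    (S : BanditRun 𝒳 𝒜 𝒪 Ω T) (B : ContextualBandit 𝒳 𝒜 𝒪) (ψ : 𝒳 × 𝒪 → 𝒜)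
    (P : Measure Ω) [IsProbabilityMeasure P] : Prop where
  param_law : HasLaw S.param B.prior P
  context_law : ∀ t, HasCondDistrib (S.context t) (fun ω => (S.history ψ t ω, S.param ω))
    (Kernel.const _ B.ctx) P
  sample_law : ∀ t, HasCondDistrib (S.sample t) (fun ω => (S.info ψ t ω, S.param ω))
    ((condDistrib S.param (S.history ψ t) P).comap
      (fun p : ((Fin (t : ℕ) → 𝒜 × 𝒳 × ℝ) × 𝒳) × 𝒪 => p.1.1) (by fun_prop)) P
  potential_law : ∀ t a, HasCondDistrib (S.potential t a)
    (fun ω => ((S.info ψ t ω, S.param ω), S.sample t ω))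
    (B.reward.comap
      (fun p : (((Fin (t : ℕ) → 𝒜 × 𝒳 × ℝ) × 𝒳) × 𝒪) × 𝒪 => (p.1.1.2, a, p.1.2)) (by fun_prop)) P

/-- `E_t[Y] = E[Y | Ĥ^t, X_t]`, as a function of the values of `(Ĥ^t, X_t)`: the mean of the
regular conditional distribution of `Y` given `(Ĥ^t, X_t)`. -/
def condMean (S : BanditRun 𝒳 𝒜 𝒪 Ω T) (ψ : 𝒳 × 𝒪 → 𝒜) (P : Measure Ω) [IsProbabilityMeasure P]
    (t : Fin T) (Y : Ω → ℝ) (hx : (Fin (t : ℕ) → 𝒜 × 𝒳 × ℝ) × 𝒳) : ℝ :=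
  ∫ y, y ∂(condDistrib Y (S.info ψ t) P hx)

variable [StandardBorelSpace 𝒜] [Nonempty 𝒜] [StandardBorelSpace 𝒪] [Nonempty 𝒪]

/-- The disintegrated conditional mutual information `I_t(Θ; R_t | Â_t)`, as a function of the
values of `(Ĥ^t, X_t)`: the mean, under the conditional law of `(Â_t, Θ)` given `(Ĥ^t, X_t)`, of
the relative entropy of the law of `R_t` given `(Ĥ^t, X_t, Â_t, Θ)` with respect to the law of
`R_t` given `(Ĥ^t, X_t, Â_t)`. -/
def condMutualInfo (S : BanditRun 𝒳 𝒜 𝒪 Ω T) (ψ : 𝒳 × 𝒪 → 𝒜) (P : Measure Ω)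
    [IsProbabilityMeasure P] (t : Fin T) (hx : (Fin (t : ℕ) → 𝒜 × 𝒳 × ℝ) × 𝒳) : ℝ≥0∞ :=
  ∫⁻ p : 𝒜 × 𝒪,
    klDiv
      (condDistrib (S.reward ψ t) (fun ω => (S.info ψ t ω, S.action ψ t ω, S.param ω)) P (hx, p))
      (condDistrib (S.reward ψ t) (fun ω => (S.info ψ t ω, S.action ψ t ω)) P (hx, p.1))
    ∂(condDistrib (fun ω => (S.action ψ t ω, S.param ω)) (S.info ψ t) P hx)

/-- The lifted information ratio `Γ_t = E_t[R⋆_t - R_t]² / I_t(Θ; R_t | Â_t)`, a random variable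
with values in `[0, ∞]`. Here `0 / 0 = 0`, `c / 0 = ∞` for `c > 0`, and `c / ∞ = 0`. -/
def liftedInfoRatio (S : BanditRun 𝒳 𝒜 𝒪 Ω T) (ψ : 𝒳 × 𝒪 → 𝒜) (P : Measure Ω)
    [IsProbabilityMeasure P] (t : Fin T) (ω : Ω) : ℝ≥0∞ :=
  ENNReal.ofReal
      (S.condMean ψ P t (fun ω' => S.optReward ψ t ω' - S.reward ψ t ω') (S.info ψ t ω) ^ 2) /
    S.condMutualInfo ψ P t (S.info ψ t ω)

end BanditRun

/-- A probability measure `μ` on `ℝ` is `v`-sub-Gaussian: if `R ∼ μ`, then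
`E[exp(l (R - E[R]))] ≤ exp(v l² / 2)` for every real `l`, the left side being finite. -/
def IsSubGaussianLaw (v : ℝ≥0) (μ : Measure ℝ) : Prop :=
  HasSubgaussianMGF (fun r : ℝ => r - ∫ y, y ∂μ) v μ

end

/-! Fix a value `x` of the history and context. The context is independent of the parameter given
the history, so `Θ` and the sampled parameter are then independent with the same law `π`, the
posterior. With `f = ψ(x, ·)`, the played action is independent of `Θ` and has the law of the
optimal action, `π.map f`. Let `D (a, θ)` be the mean reward of `a` under `θ` minus its mean under
the posterior mixture. The regret `E_t[R⋆ - R]` is the integral of `D` over the graph `θ ↦ (f θ,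
θ)`, whereas the mutual information is an integral over the product law `(π.map f).prod π`.

Two inequalities connect them. Splitting the graph by action and using Cauchy-Schwarz twice
(`sq_lintegral_apply_le`) bounds the squared regret by `|𝒜|` times the integral of `D²` under the
product law. The transport inequality (`IsSubGaussianLaw.enorm_sq_div_le_klDiv`) bounds `D²`
pointwise by `2σ²` times the relative entropy. `enorm_sq_div_lintegral_klDiv_le` combines them; the
rest identifies the conditional laws. -/

/-! ### Transport inequality for sub-Gaussian laws -/

theorem IsSubGaussianLaw.integrable_id {v : ℝ≥0} {μ : Measure ℝ} [IsProbabilityMeasure μ]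
    (h : IsSubGaussianLaw v μ) : Integrable (fun r : ℝ => r) μ := by
  have h1 := HasSubgaussianMGF.integrable h
  refine (h1.add (integrable_const (∫ y, y ∂μ))).congr (ae_of_all _ fun r => ?_)
  simp

/-- The transport inequality `|E_κ[R] - E_μ[R]|² ≤ 2 v KL(κ ‖ μ)` for a `v`-sub-Gaussian `μ`, in
the form that also makes sense for `v = 0`. -/
theorem IsSubGaussianLaw.enorm_sq_div_le_klDiv {v : ℝ≥0} {κ μ : Measure ℝ}
    [IsProbabilityMeasure κ] [IsProbabilityMeasure μ]
    (h : IsSubGaussianLaw v μ) (hκ : Integrable (fun r : ℝ => r) κ) :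
    ‖∫ r, r ∂κ - ∫ r, r ∂μ‖ₑ ^ 2 / (2 * v) ≤ klDiv κ μ := by
  by_cases htop : klDiv κ μ = ∞
  · simp [htop]
  obtain ⟨hac, hint⟩ := klDiv_ne_top_iff.1 htop
  set d := ∫ r, r ∂κ - ∫ r, r ∂μ with hd
  -- Donsker-Varadhan bound: the relative entropy of `κ` with respect to `μ` tilted by `l * (r -
  -- E_μ[R])` is nonnegative.
  have key (l : ℝ) : l * d ≤ (klDiv κ μ).toReal + v * l ^ 2 / 2 := by
    let f : ℝ → ℝ := fun r => l * (r - ∫ y, y ∂μ)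
    have hfexp : Integrable (fun r => Real.exp (f r)) μ := h.integrable_exp_mul l
    have hfκ : Integrable f κ := (hκ.sub (integrable_const _)).const_mul l
    have := isProbabilityMeasure_tilted hfexp
    have hac' : κ ≪ μ.tilted f := hac.trans (absolutelyContinuous_tilted hfexp)
    have h0 : 0 ≤ ∫ r, llr κ (μ.tilted f) r ∂κ := by
      rw [← toReal_klDiv_of_measure_eq hac' (by simp)]
      exact ENNReal.toReal_nonneg
    rw [integral_llr_tilted_right hac hfκ hfexp hint,
      ← toReal_klDiv_of_measure_eq hac (by simp)] at h0
    have hf : ∫ r, f r ∂κ = l * d := by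
      simp only [f]
      rw [integral_const_mul, integral_sub hκ (integrable_const _)]
      simp [hd]
    have hlog : Real.log (∫ r, Real.exp (f r) ∂μ) ≤ v * l ^ 2 / 2 := by
      rw [Real.log_le_iff_le_exp (integral_exp_pos hfexp)]
      exact h.mgf_le l
    linarith
  have hsq : d ^ 2 ≤ (klDiv κ μ).toReal * (2 * v) := by
    rcases eq_or_ne v 0 with rfl | hv
    · have h3 := key ((klDiv κ μ).toReal / d + 1 / d)
      by_cases hd0 : d = 0
      · simp [hd0]
      · rw [← add_div, div_mul_cancel₀ _ hd0] at h3
        simp at h3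
        linarith
    · have hv' : (0 : ℝ) < v := by positivity
      -- The maximizer of `l * d - v * l ^ 2 / 2`.
      have h1 := key (d / v)
      have h2 : d / v * d = d ^ 2 / v := by ring
      have h3 : (v : ℝ) * (d / v) ^ 2 / 2 = d ^ 2 / v / 2 := by field_simp
      rw [h2, h3] at h1
      have h4 : d ^ 2 / v ≤ (klDiv κ μ).toReal * 2 := by linarith
      rw [div_le_iff₀ hv'] at h4
      linarith
  apply ENNReal.div_le_of_le_mul
  rw [Real.enorm_eq_ofReal_abs, ← ENNReal.ofReal_pow (abs_nonneg _), sq_abs]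
  refine (ENNReal.ofReal_le_ofReal hsq).trans_eq ?_
  rw [ENNReal.ofReal_mul ENNReal.toReal_nonneg, ENNReal.ofReal_toReal htop,
    ENNReal.ofReal_mul zero_le_two]
  simp

/-! ### Cauchy-Schwarz: from the graph of `f` to the product law -/

theorem sq_lintegral_le {α : Type*} [MeasurableSpace α] (μ : Measure α) {f : α → ℝ≥0∞}
    (hf : AEMeasurable f μ) : (∫⁻ x, f x ∂μ) ^ 2 ≤ μ Set.univ * ∫⁻ x, f x ^ 2 ∂μ := by
  have h := ENNReal.lintegral_mul_le_Lp_mul_Lq μ Real.HolderConjugate.two_two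
    (aemeasurable_const (b := (1 : ℝ≥0∞))) hf
  have h2 := pow_le_pow_left' h 2
  simp only [Pi.mul_apply, one_mul, lintegral_const, ENNReal.rpow_two] at h2
  refine h2.trans_eq ?_
  rw [mul_pow]
  simp only [← ENNReal.rpow_two, ← ENNReal.rpow_mul]
  norm_num

theorem ENNReal.sq_sum_le_card_mul_sum_sq {ι : Type*} (s : Finset ι) (f : ι → ℝ≥0∞) :
    (∑ i ∈ s, f i) ^ 2 ≤ s.card * ∑ i ∈ s, f i ^ 2 := by
  have h := ENNReal.rpow_sum_le_const_mul_sum_rpow s f one_le_two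
  norm_num at h
  exact h

/-- Cauchy-Schwarz over the actions costs the factor `|𝒜|`. On each fibre `f = a` it yields the
weight `π (f ⁻¹' {a})`; enlarging the remaining integral to all `θ` then produces the product
measure. -/
theorem sq_lintegral_apply_le {𝒜 𝒪 : Type*} [Fintype 𝒜] [MeasurableSpace 𝒜]
    [DiscreteMeasurableSpace 𝒜] [MeasurableSpace 𝒪] (π : Measure 𝒪) [IsProbabilityMeasure π]
    {f : 𝒪 → 𝒜} (hf : Measurable f) {F : 𝒜 × 𝒪 → ℝ≥0∞} (hF : Measurable F) :
    (∫⁻ θ, F (f θ, θ) ∂π) ^ 2 ≤ Fintype.card 𝒜 * ∫⁻ p, F p ^ 2 ∂((π.map f).prod π) := by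
  have hFa (a : 𝒜) : Measurable fun θ => F (a, θ) := by fun_prop
  have h1 : ∫⁻ θ, F (f θ, θ) ∂π = ∑ a, ∫⁻ θ in f ⁻¹' {a}, F (a, θ) ∂π := by
    have (θ : 𝒪) : F (f θ, θ) = ∑ a, (f ⁻¹' {a}).indicator (fun θ => F (a, θ)) θ := by
      rw [Finset.sum_eq_single (f θ)]
      · simp
      · intro b _ hb
        simp [hb.symm]
      · simp
    simp_rw [this]
    rw [lintegral_finsetSum _ fun a _ => (hFa a).indicator (hf (.singleton a))]
    exact Finset.sum_congr rfl fun a _ => lintegral_indicator (hf (.singleton a)) _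
  have h2 : ∫⁻ p, F p ^ 2 ∂((π.map f).prod π)
      = ∑ a, π (f ⁻¹' {a}) * ∫⁻ θ, F (a, θ) ^ 2 ∂π := by
    rw [lintegral_prod _ (by fun_prop), lintegral_fintype]
    refine Finset.sum_congr rfl fun a _ => ?_
    rw [Measure.map_apply hf (.singleton a), mul_comm]
  rw [h1, h2]
  refine (ENNReal.sq_sum_le_card_mul_sum_sq _ _).trans ?_
  rw [Finset.card_univ]
  gcongr with a
  refine (sq_lintegral_le _ (hFa a).aemeasurable).trans ?_
  rw [Measure.restrict_apply_univ]
  gcongr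
  exact Measure.restrict_le_self

/-! ### Integrals against mixtures -/

theorem integrable_integral_of_comp {α β : Type*} [MeasurableSpace α] [MeasurableSpace β]
    {μ : Measure α} [SFinite μ] {κ : Kernel α β} [IsSFiniteKernel κ] {f : β → ℝ}
    (h : Integrable f (κ ∘ₘ μ)) : Integrable (fun x => ∫ y, f y ∂κ x) μ := by
  rw [Measure.comp_eq_comp_const_apply] at h
  simpa using Integrable.integral_comp h

theorem integral_comp_measure {α β : Type*} [MeasurableSpace α] [MeasurableSpace β]
    {μ : Measure α} [SFinite μ] {κ : Kernel α β} [IsSFiniteKernel κ] {f : β → ℝ}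
    (h : Integrable f (κ ∘ₘ μ)) : ∫ y, f y ∂(κ ∘ₘ μ) = ∫ x, ∫ y, f y ∂κ x ∂μ := by
  rw [Measure.comp_eq_comp_const_apply] at h ⊢
  simpa using Kernel.integral_comp h

/-! ### A single round with the past fixed -/

section ThompsonStep

variable {𝒜 𝒪 : Type*} [Fintype 𝒜] [MeasurableSpace 𝒜] [DiscreteMeasurableSpace 𝒜]
  [MeasurableSpace 𝒪] {π : Measure 𝒪} [IsProbabilityMeasure π] {f : 𝒪 → 𝒜}
  {k : Kernel (𝒜 × 𝒪) ℝ} [IsMarkovKernel k]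

-- The mixture along the graph of `f` is dominated by the finite sum over `a` of the mixtures with
-- fixed action.
omit [DiscreteMeasurableSpace 𝒜] [IsProbabilityMeasure π] [IsMarkovKernel k] in
theorem integrable_comp_prodMk_apply (hf : Measurable f)
    (h : ∀ a, Integrable (fun r : ℝ => r) ((k.comap (Prod.mk a) measurable_prodMk_left) ∘ₘ π)) :
    Integrable (fun r : ℝ => r) ((k.comap (fun θ => (f θ, θ)) (by fun_prop)) ∘ₘ π) := by
  have hsum : Integrable (fun r : ℝ => r)
      (∑ a, (k.comap (Prod.mk a) measurable_prodMk_left) ∘ₘ π) :=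
    integrable_finsetSum_measure.2 fun a _ => h a
  refine hsum.mono_measure ?_
  refine Measure.le_iff.2 fun s hs => ?_
  rw [Measure.bind_apply hs (Kernel.aemeasurable _), Measure.finsetSum_apply]
  simp_rw [Measure.bind_apply hs (Kernel.aemeasurable _), Kernel.comap_apply]
  have hmeas (a : 𝒜) : Measurable fun θ => k (a, θ) s :=
    (Kernel.measurable_coe k hs).comp measurable_prodMk_left
  rw [← lintegral_finsetSum _ fun a _ => hmeas a]
  exact lintegral_mono fun θ =>
    Finset.single_le_sum (f := fun a => k (a, θ) s) (fun _ _ => zero_le) (Finset.mem_univ (f θ))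

omit [Fintype 𝒜] [DiscreteMeasurableSpace 𝒜] [IsMarkovKernel k] in
theorem comp_prod_eq_comp_map (hf : Measurable f) (m : Kernel 𝒜 ℝ) [IsMarkovKernel m]
    (hm : ∀ a, m a = (k.comap (Prod.mk a) measurable_prodMk_left) ∘ₘ π) :
    k ∘ₘ ((π.map f).prod π) = (m.comap f hf) ∘ₘ π := by
  ext s hs
  rw [Measure.bind_apply hs (Kernel.aemeasurable _), Measure.bind_apply hs (Kernel.aemeasurable _),
    lintegral_prod _ (Kernel.measurable_coe k hs).aemeasurable,
    lintegral_map (by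
      exact Measurable.lintegral_prod_right' (Kernel.measurable_coe k hs)) hf]
  refine lintegral_congr fun θ => ?_
  rw [Kernel.comap_apply, hm, Measure.bind_apply hs (Kernel.aemeasurable _)]
  rfl

omit [DiscreteMeasurableSpace 𝒜] [IsMarkovKernel k] in
theorem integrable_comp_prod (hf : Measurable f) (m : Kernel 𝒜 ℝ) [IsMarkovKernel m]
    (hm : ∀ a, m a = (k.comap (Prod.mk a) measurable_prodMk_left) ∘ₘ π)
    (h : ∀ a, Integrable (fun r : ℝ => r) (m a)) :
    Integrable (fun r : ℝ => r) (k ∘ₘ ((π.map f).prod π)) := by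
  rw [comp_prod_eq_comp_map hf m hm]
  -- Applied to a kernel that ignores `θ`, whose mixture for fixed `a` is just `m a`.
  exact integrable_comp_prodMk_apply (k := m.comap Prod.fst measurable_fst) hf fun a => by
    have : (((m.comap Prod.fst measurable_fst).comap (Prod.mk a) measurable_prodMk_left) :
        Kernel 𝒪 ℝ) = Kernel.const _ (m a) := by ext; rfl
    rw [this]
    simpa using h a

/-- The bound on the information ratio in a single round, given the past: `π` is the posterior,
`f` the optimal action as a function of the parameter. -/
theorem enorm_sq_div_lintegral_klDiv_le (hf : Measurable f) {v : ℝ≥0}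
    (m : Kernel 𝒜 ℝ) [IsMarkovKernel m]
    (hm : ∀ a, m a = (k.comap (Prod.mk a) measurable_prodMk_left) ∘ₘ π)
    (hsub : ∀ a, IsSubGaussianLaw v (m a)) :
    ‖∫ r, r ∂((k.comap (fun θ => (f θ, θ)) (by fun_prop)) ∘ₘ π)
        - ∫ r, r ∂(k ∘ₘ ((π.map f).prod π))‖ₑ ^ 2
      / ∫⁻ p, klDiv (k p) (m p.1) ∂((π.map f).prod π) ≤ 2 * v * Fintype.card 𝒜 := by
  have hint (a : 𝒜) : Integrable (fun r : ℝ => r)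
      ((k.comap (Prod.mk a) measurable_prodMk_left) ∘ₘ π) := by
    rw [← hm]; exact (hsub a).integrable_id
  have hQ' := integrable_comp_prodMk_apply hf hint
  have hQ := integrable_comp_prod hf m hm fun a => (hsub a).integrable_id
  rw [comp_prod_eq_comp_map hf m hm] at hQ ⊢
  let D : 𝒜 × 𝒪 → ℝ := fun p => ∫ r, r ∂(k p) - ∫ r, r ∂(m p.1)
  have hD : Measurable D := by
    have h1 : StronglyMeasurable fun p => ∫ r, r ∂(k p) :=
      StronglyMeasurable.integral_kernel (f := fun r : ℝ => r) stronglyMeasurable_id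
    exact h1.measurable.sub ((measurable_of_finite fun a => ∫ r, r ∂(m a)).comp measurable_fst)
  have hΔ : ∫ r, r ∂((k.comap (fun θ => (f θ, θ)) (by fun_prop)) ∘ₘ π)
        - ∫ r, r ∂((m.comap f hf) ∘ₘ π) = ∫ θ, D (f θ, θ) ∂π := by
    rw [integral_comp_measure hQ', integral_comp_measure hQ,
      ← integral_sub (integrable_integral_of_comp hQ')
        (integrable_integral_of_comp hQ)]
    rfl
  set I := ∫⁻ p, klDiv (k p) (m p.1) ∂((π.map f).prod π)
  set J := ∫⁻ p, ‖D p‖ₑ ^ 2 ∂((π.map f).prod π)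
  have hJ : ‖∫ θ, D (f θ, θ) ∂π‖ₑ ^ 2 ≤ Fintype.card 𝒜 * J := by
    refine le_trans ?_ (sq_lintegral_apply_le π hf hD.enorm)
    gcongr
    exact enorm_integral_le_lintegral_enorm _
  have hkint : ∀ᵐ p ∂((π.map f).prod π), Integrable (fun r : ℝ => r) (k p) := by
    rw [← comp_prod_eq_comp_map hf m hm] at hQ
    exact Measure.ae_integrable_of_integrable_comp hQ
  have := Measure.isProbabilityMeasure_map (μ := π) hf.aemeasurable
  have hI : J / (2 * v) ≤ I := by
    simp_rw [J, div_eq_mul_inv]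
    rw [← lintegral_mul_const _ (by fun_prop)]
    refine lintegral_mono_ae ?_
    filter_upwards [hkint] with p hp
    exact (hsub p.1).enorm_sq_div_le_klDiv hp
  rw [hΔ]
  by_cases hItop : I = ∞
  · simp [hItop, ENNReal.div_top]
  apply ENNReal.div_le_of_le_mul
  have hJI : J ≤ I * (2 * v) := by
    -- If `v = 0` and `J ≠ 0`, then `J / 0 = ∞` forces `I = ∞`, which is excluded.
    rcases eq_or_ne v 0 with rfl | hv
    · by_cases hJ0 : J = 0
      · simp [hJ0]
      · simp [ENNReal.div_zero hJ0] at hI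
        exact absurd hI hItop
    · rwa [ENNReal.div_le_iff (by simp [hv]) (by finiteness)] at hI
  calc _ ≤ (Fintype.card 𝒜 : ℝ≥0∞) * J := hJ
    _ ≤ Fintype.card 𝒜 * (I * (2 * v)) := by gcongr
    _ = _ := by ring

end ThompsonStep

/-! ### Calculus of conditional distributions -/

section HasCondDistrib

variable {Ω 𝓧 𝓨 𝓩 : Type*} [MeasurableSpace Ω] [MeasurableSpace 𝓧] [MeasurableSpace 𝓨]
  [MeasurableSpace 𝓩] {P : Measure Ω} [IsFiniteMeasure P]
  {X : Ω → 𝓧} {Y : Ω → 𝓨} {Z : Ω → 𝓩}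

omit [IsFiniteMeasure P] in
theorem ProbabilityTheory.HasCondDistrib.compProd {η : Kernel 𝓧 𝓩} [IsMarkovKernel η]
    {κ : Kernel (𝓧 × 𝓩) 𝓨} [IsMarkovKernel κ] (hZ : HasCondDistrib Z X η P)
    (hY : HasCondDistrib Y (fun ω => (X ω, Z ω)) κ P) :
    HasCondDistrib (fun ω => (Z ω, Y ω)) X (η ⊗ₖ κ) P where
  aemeasurable := by
    have h1 := hY.aemeasurable_snd
    have h2 := hZ.aemeasurable_snd
    have h3 := hZ.aemeasurable_fst
    fun_prop
  map_eq := by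
    have h1 := hY.aemeasurable_snd
    have h2 := hZ.aemeasurable_snd
    have h3 := hZ.aemeasurable_fst
    have h := hY.map_eq
    rw [hZ.map_eq] at h
    rw [← Measure.compProd_assoc', ← h,
      AEMeasurable.map_map_of_aemeasurable (by fun_prop) (by fun_prop)]
    rfl

/-- The law of `Y` given `X` is the mixture over `Z` of the laws of `Y` given `(X, Z)`. -/
theorem ProbabilityTheory.HasCondDistrib.marginalize {η : Kernel 𝓧 𝓩} [IsMarkovKernel η]
    {κ : Kernel (𝓧 × 𝓩) 𝓨} [IsMarkovKernel κ] (hZ : HasCondDistrib Z X η P)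
    (hY : HasCondDistrib Y (fun ω => (X ω, Z ω)) κ P) :
    HasCondDistrib Y X (η ⊗ₖ κ).snd P :=
  (HasCondDistrib.compProd hZ hY).snd

theorem snd_compProd_apply_eq_comp (η : Kernel 𝓧 𝓩) [IsSFiniteKernel η]
    (κ : Kernel (𝓧 × 𝓩) 𝓨) [IsSFiniteKernel κ] (x : 𝓧) :
    (η ⊗ₖ κ).snd x = (κ.comap (Prod.mk x) measurable_prodMk_left) ∘ₘ η x := by
  ext s hs
  rw [Kernel.snd_apply' _ _ hs, Kernel.compProd_apply (measurable_snd hs),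
    Measure.bind_apply hs (Kernel.aemeasurable _)]
  rfl

theorem compProd_prodMkRight (η : Kernel 𝓧 𝓩) [IsSFiniteKernel η] (κ : Kernel 𝓧 𝓨)
    [IsSFiniteKernel κ] : η ⊗ₖ (κ.prodMkRight 𝓩) = η ×ₖ κ := by
  ext x s hs
  rw [Kernel.compProd_apply hs, Kernel.prod_apply' _ _ _ hs]
  rfl

/-- If `Y` is independent of `Z` given `X`, then `Z` is independent of `Y` given `X`. -/
theorem ProbabilityTheory.HasCondDistrib.symm_of_prodMkRight {η : Kernel 𝓧 𝓩} [IsMarkovKernel η]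
    {κ : Kernel 𝓧 𝓨} [IsMarkovKernel κ] (hZ : HasCondDistrib Z X η P)
    (hY : HasCondDistrib Y (fun ω => (X ω, Z ω)) (κ.prodMkRight 𝓩) P) :
    HasCondDistrib (fun ω => (Y ω, Z ω)) X (κ ×ₖ η) P ∧
    HasCondDistrib Z (fun ω => (X ω, Y ω)) (η.prodMkRight 𝓨) P := by
  have h := HasCondDistrib.compProd hZ hY
  rw [compProd_prodMkRight] at h
  have h' : HasCondDistrib (fun ω => (Y ω, Z ω)) X ((η ×ₖ κ).map Prod.swap) P :=
    h.comp_left measurable_swap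
  rw [Kernel.map_prod_swap] at h'
  refine ⟨h', ?_⟩
  rw [← compProd_prodMkRight] at h'
  exact h'.of_compProd

theorem ProbabilityTheory.HasCondDistrib.comp_left_prodMk {κ : Kernel 𝓧 𝓨} [IsMarkovKernel κ]
    (h : HasCondDistrib Y X κ P) {f : 𝓧 × 𝓨 → 𝓩} (hf : Measurable f) :
    HasCondDistrib (fun ω => f (X ω, Y ω)) X ((Kernel.id ×ₖ κ).map f) P := by
  have hX := h.aemeasurable_fst
  have hY := h.aemeasurable_snd
  refine ⟨hX.prodMk (hf.comp_aemeasurable (hX.prodMk hY)), ?_⟩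
  ext s hs
  have hg : Measurable fun p : 𝓧 × 𝓨 => (p.1, f p) := measurable_fst.prodMk hf
  have hmap : P.map (fun ω => (X ω, f (X ω, Y ω)))
      = (P.map fun ω => (X ω, Y ω)).map fun p => (p.1, f p) := by
    rw [AEMeasurable.map_map_of_aemeasurable (by fun_prop) (by fun_prop)]
    rfl
  rw [hmap, h.map_eq, Measure.map_apply hg hs, Measure.compProd_apply (hg hs),
    Measure.compProd_apply hs]
  refine lintegral_congr fun x => ?_
  rw [Kernel.map_apply' _ hf _ (measurable_prodMk_left hs),
    Kernel.prod_apply' _ _ _ (hf (measurable_prodMk_left hs)), Kernel.id_apply,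
    lintegral_dirac' _ (measurable_measure_prodMk_left (hf (measurable_prodMk_left hs)))]
  rfl

/-- The conditional law of a variable selected among finitely many ones. -/
theorem ProbabilityTheory.HasCondDistrib.select {𝒜 : Type*} [Fintype 𝒜] [MeasurableSpace 𝒜]
    [DiscreteMeasurableSpace 𝒜] {Y : 𝒜 → Ω → 𝓨} {K : Kernel (𝒜 × 𝓧) 𝓨} [IsMarkovKernel K]
    (hX : AEMeasurable X P)
    (h : ∀ a, HasCondDistrib (Y a) X (K.comap (Prod.mk a) measurable_prodMk_left) P)
    {f : 𝓧 → 𝒜} (hf : Measurable f) :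
    HasCondDistrib (fun ω => Y (f (X ω)) ω) X (K.comap (fun x => (f x, x)) (by fun_prop)) P := by
  have hY (a : 𝒜) : AEMeasurable (Y a) P := (h a).aemeasurable_snd
  have hYm : AEMeasurable (fun ω => Y (f (X ω)) ω) P := by
    -- Measurable versions of the `Y a` are jointly measurable in `(a, ω)` because `𝒜` is countable.
    refine ⟨fun ω => (hY (f (hX.mk X ω))).mk _ ω, ?_, ?_⟩
    · have : Measurable fun p : 𝒜 × Ω => (hY p.1).mk _ p.2 :=
        measurable_from_prod_countable_right fun a => (hY a).measurable_mk
      exact this.comp ((hf.comp hX.measurable_mk).prodMk measurable_id)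
    · filter_upwards [hX.ae_eq_mk, ae_all_iff.2 fun a => (hY a).ae_eq_mk] with ω h1 h2
      rw [h2, h1]
  refine ⟨hX.prodMk hYm, ?_⟩
  ext s hs
  -- On the piece `f x = a` the selected variable is `Y a` and the selected kernel is that of `a`.
  have hpart (a : 𝒜) : P.map (fun ω => (X ω, Y (f (X ω)) ω)) (s ∩ (f ∘ Prod.fst) ⁻¹' {a})
      = (P.map X ⊗ₘ (K.comap (fun x => (f x, x)) (by fun_prop))) (s ∩ (f ∘ Prod.fst) ⁻¹' {a}) := by
    have hsa : MeasurableSet (s ∩ (f ∘ Prod.fst) ⁻¹' {a} : Set (𝓧 × 𝓨)) :=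
      hs.inter ((hf.comp measurable_fst) (.singleton a))
    trans P.map (fun ω => (X ω, Y a ω)) (s ∩ (f ∘ Prod.fst) ⁻¹' {a})
    · rw [Measure.map_apply_of_aemeasurable (hX.prodMk hYm) hsa,
        Measure.map_apply_of_aemeasurable (hX.prodMk (hY a)) hsa]
      congr 1
      ext ω
      simp only [Set.mem_preimage, Set.mem_inter_iff, Function.comp_apply, Set.mem_singleton_iff]
      constructor <;> rintro ⟨h1, rfl⟩ <;> exact ⟨h1, rfl⟩
    · rw [(h a).map_eq, Measure.compProd_apply hsa, Measure.compProd_apply hsa]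
      refine lintegral_congr fun x => ?_
      by_cases hx : f x = a
      · simp [Kernel.comap_apply, hx]
      · have : Prod.mk x ⁻¹' (s ∩ (f ∘ Prod.fst) ⁻¹' {a}) = (∅ : Set 𝓨) := by
          ext y; simp [hx]
        simp [this]
  have hs_eq : s = ⋃ a, s ∩ (f ∘ Prod.fst) ⁻¹' {a} := by
    ext p; simp
  rw [hs_eq, measure_iUnion, measure_iUnion]
  · simp_rw [hpart]
  all_goals first
    | exact fun a => hs.inter ((hf.comp measurable_fst) (.singleton a))
    | (intro a b hab
       refine Set.disjoint_left.2 ?_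
       rintro p ⟨-, h1⟩ ⟨-, h2⟩
       exact hab (h1.symm.trans h2))

theorem ProbabilityTheory.HasCondDistrib.condDistrib_ae_eq [StandardBorelSpace 𝓨] [Nonempty 𝓨] {κ : Kernel 𝓧 𝓨}
    [IsFiniteKernel κ] (h : HasCondDistrib Y X κ P) : condDistrib Y X P =ᵐ[P.map X] κ :=
  condDistrib_ae_eq_of_measure_eq_compProd X h.aemeasurable_snd h.map_eq

theorem hasCondDistrib_condDistrib [StandardBorelSpace 𝓨] [Nonempty 𝓨] (hX : AEMeasurable X P)
    (hY : AEMeasurable Y P) : HasCondDistrib Y X (condDistrib Y X P) P :=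
  ⟨hX.prodMk hY, (compProd_map_condDistrib hY).symm⟩

theorem id_prod_map_apply (κ : Kernel 𝓧 𝓨) [IsSFiniteKernel κ] {f : 𝓧 × 𝓨 → 𝓩}
    (hf : Measurable f) (x : 𝓧) :
    (Kernel.id ×ₖ κ).map f x = (κ x).map fun y => f (x, y) := by
  ext s hs
  rw [Kernel.map_apply' _ hf _ hs, Kernel.prod_apply' _ _ _ (hf hs), Kernel.id_apply,
    lintegral_dirac' _ (measurable_measure_prodMk_left (hf hs)),
    Measure.map_apply (by fun_prop) hs]
  rfl

end HasCondDistrib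

/-! ### Conditional laws of the rewards in a round -/

section Round

variable {E 𝒜 𝒪 Ω : Type*} [MeasurableSpace E] [MeasurableSpace 𝒜] [MeasurableSpace 𝒪]
  [MeasurableSpace Ω] {P : Measure Ω} [IsFiniteMeasure P] {I : Ω → E} {Θ Θs : Ω → 𝒪}
  {π : Kernel E 𝒪} [IsMarkovKernel π] {g : E × 𝒪 → 𝒜}

/-- In a round of Thompson sampling, the action and the parameter are independent given the
past. -/
theorem hasCondDistrib_action_param (hg : Measurable g) (hΘ : HasCondDistrib Θ I π P)
    (hΘs : HasCondDistrib Θs (fun ω => (I ω, Θ ω)) (π.prodMkRight 𝒪) P) :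
    HasCondDistrib (fun ω => (g (I ω, Θs ω), Θ ω)) I ((Kernel.id ×ₖ π).map g ×ₖ π) P ∧
    HasCondDistrib Θ (fun ω => (I ω, g (I ω, Θs ω))) (π.prodMkRight 𝒜) P := by
  have : IsMarkovKernel ((Kernel.id ×ₖ π).map g) := Kernel.IsMarkovKernel.map _ hg
  refine HasCondDistrib.symm_of_prodMkRight hΘ ?_
  have hf : Measurable fun p : (E × 𝒪) × 𝒪 => g (p.1.1, p.2) := by fun_prop
  have h := hΘs.comp_left_prodMk hf
  have hk : ((Kernel.id ×ₖ π).map g).prodMkRight 𝒪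
      = (Kernel.id ×ₖ π.prodMkRight 𝒪).map fun p : (E × 𝒪) × 𝒪 => g (p.1.1, p.2) := by
    ext1 x
    rw [id_prod_map_apply _ hf, Kernel.prodMkRight_apply, id_prod_map_apply _ hg]
    rfl
  rwa [hk]

variable [Fintype 𝒜] [Nonempty 𝒜] [DiscreteMeasurableSpace 𝒜] {Y : 𝒜 → Ω → ℝ}
  {k : Kernel (E × 𝒜 × 𝒪) ℝ} [IsMarkovKernel k]
  (hY : ∀ a, HasCondDistrib (Y a) (fun ω => ((I ω, Θ ω), Θs ω))
    (k.comap (fun p : (E × 𝒪) × 𝒪 => (p.1.1, a, p.1.2)) (by fun_prop)) P)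
include hY

omit [Fintype 𝒜] [Nonempty 𝒜] [DiscreteMeasurableSpace 𝒜] in
theorem hasCondDistrib_potential (hΘ : HasCondDistrib Θ I π P) (a : 𝒜) :
    HasCondDistrib (Y a) I
      (π ⊗ₖ k.comap (fun p : E × 𝒪 => (p.1, a, p.2)) (by fun_prop)).snd P := by
  refine hΘ.marginalize ?_
  exact HasCondDistrib.comp_right
    (κ := k.comap (fun p : E × 𝒪 => (p.1, a, p.2)) (by fun_prop)) (f := Prod.fst)
    (hf := measurable_fst) (Z := fun ω => ((I ω, Θ ω), Θs ω)) (hY a)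

/-- The reward law in `hY` is conditional on both parameters, so the selected action may depend on
both. -/
theorem hasCondDistrib_select {f : (E × 𝒪) × 𝒪 → 𝒜} (hf : Measurable f) :
    HasCondDistrib (fun ω => Y (f ((I ω, Θ ω), Θs ω)) ω) (fun ω => ((I ω, Θ ω), Θs ω))
      (k.comap (fun p => (p.1.1, f p, p.1.2)) (by fun_prop)) P := by
  exact HasCondDistrib.select
    (K := k.comap (fun q : 𝒜 × ((E × 𝒪) × 𝒪) => (q.2.1.1, q.1, q.2.1.2)) (by fun_prop))
    (hY (Classical.arbitrary 𝒜)).aemeasurable_fst hY hf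

theorem hasCondDistrib_optReward (hg : Measurable g) (hΘ : HasCondDistrib Θ I π P) :
    HasCondDistrib (fun ω => Y (g (I ω, Θ ω)) ω) I
      (π ⊗ₖ k.comap (fun p : E × 𝒪 => (p.1, g p, p.2)) (by fun_prop)).snd P := by
  refine hΘ.marginalize ?_
  exact HasCondDistrib.comp_right
    (κ := k.comap (fun p : E × 𝒪 => (p.1, g p, p.2)) (by fun_prop)) (f := Prod.fst)
    (hf := measurable_fst) (Z := fun ω => ((I ω, Θ ω), Θs ω))
    (hasCondDistrib_select hY (f := fun p => g p.1) (by fun_prop))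

theorem hasCondDistrib_reward_of_action_param (hg : Measurable g) :
    HasCondDistrib (fun ω => Y (g (I ω, Θs ω)) ω) (fun ω => (I ω, g (I ω, Θs ω), Θ ω)) k P :=
  HasCondDistrib.comp_right (κ := k) (Z := fun ω => ((I ω, Θ ω), Θs ω))
    (f := fun p : (E × 𝒪) × 𝒪 => (p.1.1, g (p.1.1, p.2), p.1.2))
    (hf := by fun_prop) (hasCondDistrib_select hY (f := fun p => g (p.1.1, p.2)) (by fun_prop))

/-- The action carries no further information on `Θ`, so the reward kernel is averaged over the
unchanged posterior `π`. -/
theorem hasCondDistrib_reward_of_action (hg : Measurable g) (hΘ : HasCondDistrib Θ I π P)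
    (hΘs : HasCondDistrib Θs (fun ω => (I ω, Θ ω)) (π.prodMkRight 𝒪) P) :
    HasCondDistrib (fun ω => Y (g (I ω, Θs ω)) ω) (fun ω => (I ω, g (I ω, Θs ω)))
      (π.prodMkRight 𝒜 ⊗ₖ k.comap (fun p : (E × 𝒜) × 𝒪 => (p.1.1, p.1.2, p.2))
        (by fun_prop)).snd P := by
  refine (hasCondDistrib_action_param hg hΘ hΘs).2.marginalize ?_
  exact HasCondDistrib.comp_right
    (κ := k.comap (fun p : (E × 𝒜) × 𝒪 => (p.1.1, p.1.2, p.2)) (by fun_prop))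
    (Z := fun ω => ((I ω, Θ ω), Θs ω)) (f := fun p : (E × 𝒪) × 𝒪 => ((p.1.1, g (p.1.1, p.2)), p.1.2))
    (hf := by fun_prop) (hasCondDistrib_select hY (f := fun p => g (p.1.1, p.2)) (by fun_prop))

theorem hasCondDistrib_reward (hg : Measurable g) (hΘ : HasCondDistrib Θ I π P)
    (hΘs : HasCondDistrib Θs (fun ω => (I ω, Θ ω)) (π.prodMkRight 𝒪) P) :
    HasCondDistrib (fun ω => Y (g (I ω, Θs ω)) ω) I
      (((Kernel.id ×ₖ π).map g ×ₖ π) ⊗ₖ k).snd P := by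
  have : IsMarkovKernel ((Kernel.id ×ₖ π).map g) := Kernel.IsMarkovKernel.map _ hg
  exact (hasCondDistrib_action_param hg hΘ hΘs).1.marginalize
    (hasCondDistrib_reward_of_action_param hY hg)

end Round

/-! ### Assembly -/

theorem lemma1 {𝒳 𝒜 𝒪 Ω : Type*}
    [MeasurableSpace 𝒳]
    [Fintype 𝒜] [Nonempty 𝒜] [MeasurableSpace 𝒜] [DiscreteMeasurableSpace 𝒜]
    [MeasurableSpace 𝒪] [StandardBorelSpace 𝒪] [Nonempty 𝒪]
    [MeasurableSpace Ω] (P : Measure Ω) [IsProbabilityMeasure P]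
    (T : ℕ) (B : ContextualBandit 𝒳 𝒜 𝒪)
    (ψ : 𝒳 × 𝒪 → 𝒜) (hψ : B.IsOptimal T ψ)
    (S : BanditRun 𝒳 𝒜 𝒪 Ω T) (hS : S.IsThompsonSampling B ψ P)
    (σ : ℝ≥0)
    (hsub : ∀ (t : Fin T) (a : 𝒜), ∀ᵐ hx ∂(P.map (S.info ψ t)),
      IsSubGaussianLaw (σ ^ 2) (condDistrib (S.potential t a) (S.info ψ t) P hx)) :
    ∀ t : Fin T, ∀ᵐ ω ∂P,
      S.liftedInfoRatio ψ P t ω ≤ 2 * (σ : ℝ≥0∞) ^ 2 * (Fintype.card 𝒜 : ℝ≥0∞) := by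
  intro t
  have hψm : Measurable ψ := hψ.1.1
  have hH : AEMeasurable (S.history ψ t) P := (hS.context_law t).aemeasurable_fst.fst
  have hΘm : AEMeasurable S.param P := (hS.context_law t).aemeasurable_fst.snd
  have hIm : AEMeasurable (S.info ψ t) P := hH.prodMk (hS.context_law t).aemeasurable_snd
  -- the posterior given `(Ĥ^t, X_t)` is the posterior given `Ĥ^t`
  let π : Kernel ((Fin (t : ℕ) → 𝒜 × 𝒳 × ℝ) × 𝒳) 𝒪 :=
    (condDistrib S.param (S.history ψ t) P).prodMkRight 𝒳
  have hΘ : HasCondDistrib S.param (S.info ψ t) π P :=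
    ((hasCondDistrib_condDistrib hH hΘm).symm_of_prodMkRight
      (κ := Kernel.const _ B.ctx) (hS.context_law t)).2
  have hΘs : HasCondDistrib (S.sample t) (fun ω => (S.info ψ t ω, S.param ω))
    (π.prodMkRight 𝒪) P := hS.sample_law t
  let g : ((Fin (t : ℕ) → 𝒜 × 𝒳 × ℝ) × 𝒳) × 𝒪 → 𝒜 := fun p => ψ (p.1.2, p.2)
  have hg : Measurable g := by fun_prop
  let k : Kernel (((Fin (t : ℕ) → 𝒜 × 𝒳 × ℝ) × 𝒳) × 𝒜 × 𝒪) ℝ :=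
    B.reward.comap (fun p => (p.1.2, p.2.1, p.2.2)) (by fun_prop)
  have hY (a : 𝒜) : HasCondDistrib (S.potential t a)
      (fun ω => ((S.info ψ t ω, S.param ω), S.sample t ω))
      (k.comap (fun p => (p.1.1, a, p.1.2)) (by fun_prop)) P := hS.potential_law t a
  have hAΘ := (hasCondDistrib_action_param hg hΘ hΘs).1
  have hAm : AEMeasurable (fun ω => (S.action ψ t ω, S.param ω)) P := hAΘ.aemeasurable_snd
  have hR : HasCondDistrib (S.reward ψ t) (S.info ψ t) _ P := hasCondDistrib_reward hY hg hΘ hΘs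
  have hRopt : HasCondDistrib (S.optReward ψ t) (S.info ψ t) _ P :=
    hasCondDistrib_optReward hY hg hΘ
  have hRA := (hasCondDistrib_reward_of_action hY hg hΘ hΘs).condDistrib_ae_eq
  have hRAΘ := (hasCondDistrib_reward_of_action_param hY hg).condDistrib_ae_eq
  have : IsMarkovKernel ((Kernel.id ×ₖ π).map g) := Kernel.IsMarkovKernel.map _ hg
  set m := (π.prodMkRight 𝒜 ⊗ₖ k.comap (fun p : (((Fin (t : ℕ) → 𝒜 × 𝒳 × ℝ) × 𝒳) × 𝒜) × 𝒪 =>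
    (p.1.1, p.1.2, p.2)) (by fun_prop)).snd
  have hRmAΘ : ∀ᵐ x ∂(P.map fun ω => (S.info ψ t ω, (S.action ψ t ω, S.param ω))),
      condDistrib (S.reward ψ t) (fun ω => (S.info ψ t ω, S.action ψ t ω)) P (x.1, x.2.1)
        = m (x.1, x.2.1) := by
    have hmap : (P.map fun ω => (S.info ψ t ω, (S.action ψ t ω, S.param ω))).map
        (fun x => (x.1, x.2.1)) = P.map fun ω => (S.info ψ t ω, S.action ψ t ω) := by
      rw [AEMeasurable.map_map_of_aemeasurable (by fun_prop) (by fun_prop)]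
      rfl
    refine ae_of_ae_map (f := fun x : ((Fin (t : ℕ) → 𝒜 × 𝒳 × ℝ) × 𝒳) × 𝒜 × 𝒪 => (x.1, x.2.1))
      (by fun_prop) (p := fun y => condDistrib (S.reward ψ t)
        (fun ω => (S.info ψ t ω, S.action ψ t ω)) P y = m y) ?_
    rw [hmap]
    exact hRA
  -- Disintegration turns the almost sure identities into identities for almost every `(a, θ)`,
  -- given almost every `x`.
  have hkl := Measure.ae_ae_of_ae_compProd
    ((compProd_map_condDistrib (X := S.info ψ t) hAm).symm ▸ (hRAΘ.and hRmAΘ))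
  have hpair : AEMeasurable (fun ω => (S.optReward ψ t ω, S.reward ψ t ω)) P :=
    hRopt.aemeasurable_snd.prodMk hR.aemeasurable_snd
  -- All three conditional laws are images of the conditional law of the pair `(R⋆, R)`, under which
  -- the mean is additive.
  have hmean : ∀ᵐ x ∂(P.map (S.info ψ t)),
    Integrable (fun r : ℝ => r) (condDistrib (S.optReward ψ t) (S.info ψ t) P x) →
    Integrable (fun r : ℝ => r) (condDistrib (S.reward ψ t) (S.info ψ t) P x) →
      S.condMean ψ P t (fun ω' => S.optReward ψ t ω' - S.reward ψ t ω') x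
        = ∫ r, r ∂(condDistrib (S.optReward ψ t) (S.info ψ t) P x)
          - ∫ r, r ∂(condDistrib (S.reward ψ t) (S.info ψ t) P x) := by
    filter_upwards [condDistrib_comp (S.info ψ t) hpair measurable_fst,
      condDistrib_comp (S.info ψ t) hpair measurable_snd,
      condDistrib_comp (S.info ψ t) hpair (measurable_fst.sub measurable_snd)] with x h1 h2 h3
    change condDistrib (S.optReward ψ t) (S.info ψ t) P x = _ at h1
    change condDistrib (S.reward ψ t) (S.info ψ t) P x = _ at h2
    change condDistrib (fun ω' => S.optReward ψ t ω' - S.reward ψ t ω') (S.info ψ t) P x = _ at h3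
    rw [BanditRun.condMean, h1, h2, h3, Kernel.map_apply _ measurable_fst,
      Kernel.map_apply _ measurable_snd, Kernel.map_apply _ (measurable_fst.sub measurable_snd)]
    intro i1 i2
    rw [integrable_map_measure (by fun_prop) (by fun_prop)] at i1 i2
    rw [integral_map (by fun_prop) (by fun_prop), integral_map (by fun_prop) (by fun_prop),
      integral_map (by fun_prop) (by fun_prop)]
    exact integral_sub i1 i2
  unfold BanditRun.liftedInfoRatio
  refine ae_of_ae_map hIm (p := fun x => ENNReal.ofReal (S.condMean ψ P t
    (fun ω' => S.optReward ψ t ω' - S.reward ψ t ω') x ^ 2) / S.condMutualInfo ψ P t x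
      ≤ 2 * (σ : ℝ≥0∞) ^ 2 * (Fintype.card 𝒜 : ℝ≥0∞)) ?_
  filter_upwards [hkl, hmean, hR.condDistrib_ae_eq, hRopt.condDistrib_ae_eq,
    hAΘ.condDistrib_ae_eq, ae_all_iff.2 (hsub t),
    ae_all_iff.2 fun a => (hasCondDistrib_potential hY hΘ a).condDistrib_ae_eq]
    with x hkl hmean hR hRopt hAΘ hsub hpot
  change condDistrib (fun ω => (S.action ψ t ω, S.param ω)) (S.info ψ t) P x = _ at hAΘ
  let f : 𝒪 → 𝒜 := fun θ => g (x, θ)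
  have hf : Measurable f := by fun_prop
  let kx : Kernel (𝒜 × 𝒪) ℝ := k.comap (Prod.mk x) measurable_prodMk_left
  let mx : Kernel 𝒜 ℝ := m.comap (Prod.mk x) measurable_prodMk_left
  have hmx (a : 𝒜) : mx a = (kx.comap (Prod.mk a) measurable_prodMk_left) ∘ₘ π x :=
    snd_compProd_apply_eq_comp _ _ _
  rw [Kernel.prod_apply, id_prod_map_apply _ hg] at hAΘ
  rw [snd_compProd_apply_eq_comp, Kernel.prod_apply, id_prod_map_apply _ hg] at hR
  rw [snd_compProd_apply_eq_comp] at hRopt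
  have hsubm (a : 𝒜) : IsSubGaussianLaw (σ ^ 2) (mx a) := by
    have h := hsub a
    rw [hpot a, snd_compProd_apply_eq_comp] at h
    rw [hmx]
    exact h
  have hint (a : 𝒜) : Integrable (fun r : ℝ => r) (mx a) := (hsubm a).integrable_id
  have hI : S.condMutualInfo ψ P t x
      = ∫⁻ p, klDiv (kx p) (mx p.1) ∂(((π x).map f).prod (π x)) := by
    rw [BanditRun.condMutualInfo, hAΘ]
    refine lintegral_congr_ae ?_
    rw [hAΘ] at hkl
    filter_upwards [hkl] with p hp
    exact congrArg₂ klDiv hp.1 hp.2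
  have hΔ := hmean
    (by rw [hRopt]
        exact integrable_comp_prodMk_apply (k := kx) hf fun a => by rw [← hmx]; exact hint a)
    (by rw [hR]; exact integrable_comp_prod (k := kx) hf mx hmx hint)
  rw [hΔ, hI, hR, hRopt, ← sq_abs, ENNReal.ofReal_pow (abs_nonneg _), ← Real.enorm_eq_ofReal_abs]
  have h := enorm_sq_div_lintegral_klDiv_le (k := kx) hf mx hmx hsubm
  rw [ENNReal.coe_pow] at h
  exact h
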